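/- Let $0<p<1$. Let $F_0=1$, $F_1=2$, $F_n=F_{n-1}+F_{n-2}$ for $n\ge 2$, and write every integer $N\ge 0$ uniquely as $N=\sum_i\varepsilon_i(N)F_i$ with digits $\varepsilon_i(N)\in\{0,1\}$, only finitely many of them nonzero and no two consecutive ones equal to $1$. The *stochastic Fibonacci adding machine* is the Markov chain on $\{0,1,2,\dots\}$ given by the following probabilistic transducer with initial state $I$ and terminal state $T$, which reads the digits of $N$ (preceded by infinitely many zeros) from right to left, i.e. from the least significant digit on. An edge labelled $a/b$ reads the word $a$ and writes the word $b$. The edges are: from $T$ to $T$, $0/0$ and $1/1$, with probability $1$; from $I$ to $I$, $10/00$ and $101/000$, with probability $p$; from $I$ to $T$, $00/01$ and $001/010$, with probability $p$; from $I$ to $T$, $10/10$, $101/101$, $00/00$ and $001/001$, with probability $1-p$. The transition probability $p_{N,M}$ is the sum, over all paths that start in $I$, end in $T$, read the digits of $N$ and write a word representing $M$ in the base $(F_i)$, of the products of the probabilities of the edges. Let $S_p=(p_{N,M})_{N,M\ge 0}$, acting on complex sequences by $(S_px)_N=\sum_M p_{N,M}x_M$. For $\lambda\in\mathbb C$ put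 $$q_{F_0}(\lambda)=\frac{\lambda-(1-p)}{p},\qquad q_{F_1}(\lambda)=q_{F_0}(\lambda)^2,\qquad q_{F_n}(\lambda)=\frac1p\,q_{F_{n-1}}(\lambda)\,q_{F_{n-2}}(\lambda)-\frac{1-p}{p}\quad(n\ge 2),$$ and let $\mathcal E_p=\{\lambda\in\mathbb C:\ (q_{F_n}(\lambda))_{n\ge0}\text{ is bounded}\}$. Then $$\mathcal E_p=\{\lambda\in\mathbb C:\ (\lambda_1,\lambda)\in J(g)\},\qquad \lambda_1=1-p+\frac{(1-\lambda-p)^2}{p},$$ where $J(g)$ is the filled Julia set (the set of points with bounded forward orbit) of $g:\mathbb C^2\to\mathbb C^2$, $g(x,y)=\left(\frac{(x-1+p)(y-1+p)}{p^2},\,x\right)$. Moreover, $S_p$ is a bounded operator on each of the Banach spaces $\ell^\infty$, $c_0$ (sequences converging to $0$), $c$ (convergent sequences) and $\ell^\alpha$ for every real $\alpha\ge1$, and on each of them its spectrum contains $\mathcal E_p$. -/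

import Mathlib

open Filter Topology
open scoped ENNReal

namespace FibAdding

/-! ### Fibonacci representations

The base is `F 0 = 1`, `F 1 = 2`, `F n = F (n-1) + F (n-2)`, that is, `F i = Nat.fib (i + 2)`.
A word is a list of binary digits, *least significant digit first*. -/

/-- The Fibonacci numbers `F 0 = 1, F 1 = 2, F 2 = 3, F 3 = 5, …`. -/
def F (i : ℕ) : ℕ := Nat.fib (i + 2)

/-- The digit `ε i` of `N` in its Fibonacci (Zeckendorf, greedy) representation
`N = ∑ i, ε i * F i` without two consecutive digits `1`. -/
def digit (N i : ℕ) : Bool := decide (i + 2 ∈ N.zeckendorf)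

/-- The digits of `N`, least significant first, padded with zeros: `N` is less than `F N`, so that
there are at least three leading zeros, which is enough for every path of the transducer
below to have reached its terminal state. -/
def digits (N : ℕ) : List Bool := (List.range (N + 3)).map (digit N)

/-- The number `∑ i, w i * F i` represented by the word `w`. -/
def value (w : List Bool) : ℕ :=
  ∑ i ∈ Finset.range w.length, if w.getD i false then F i else 0

/-! ### The stochastic Fibonacci adding machine -/

/-- The states of the transducer: initial and terminal. -/
inductive State
  | I
  | T

/-- All the paths of the probabilistic transducer that start in the given state, read the given
word (least significant digit first) completely and end in the terminal state. Each path is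
recorded as the word it writes together with its probability, the product of the
probabilities of its edges.

In the usual notation, in which the least significant digit is the rightmost one, the edges are
* `T → T`: `0/0` and `1/1`, with probability `1`;
* `I → I`: `10/00` and `101/000`, with probability `p`;
* `I → T`: `00/01` and `001/010`, with probability `p`;
* `I → T`: `10/10`, `101/101`, `00/00` and `001/001`, with probability `1 - p`. -/
noncomputable def paths (p : ℝ) : State → List Bool → List (List Bool × ℝ)
  | .T, [] => [([], 1)]
  | .T, d :: u => (paths p .T u).map fun o => (d :: o.1, 1 * o.2)
  | .I, false :: true :: u =>
      (paths p .I u).map (fun o => (false :: false :: o.1, p * o.2)) ++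
      (paths p .T u).map (fun o => (false :: true :: o.1, (1 - p) * o.2))
  | .I, true :: false :: true :: u =>
      (paths p .I u).map (fun o => (false :: false :: false :: o.1, p * o.2)) ++
      (paths p .T u).map (fun o => (true :: false :: true :: o.1, (1 - p) * o.2))
  | .I, false :: false :: u =>
      (paths p .T u).map (fun o => (true :: false :: o.1, p * o.2)) ++
      (paths p .T u).map (fun o => (false :: false :: o.1, (1 - p) * o.2))
  | .I, true :: false :: false :: u =>
      (paths p .T u).map (fun o => (false :: true :: false :: o.1, p * o.2)) ++
      (paths p .T u).map (fun o => (true :: false :: false :: o.1, (1 - p) * o.2))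
  | .I, _ => []

/-- The probability that the stochastic Fibonacci adding machine makes a transition from `N` to `M`:
the total probability of the paths that start in the initial state, read the digits of `N`
and write a word that represents `M`. -/
noncomputable def transProb (p : ℝ) (N M : ℕ) : ℝ :=
  ((paths p .I (digits N)).map fun o => if value o.1 = M then o.2 else 0).sum

/-- The sequence `y` is the product of the transition matrix `S_p` and the (column) sequence `x`,
i.e. `y N = ∑ M, p_{N,M} * x M` for all `N`. -/
def IsTransition (p : ℝ) (x y : ℕ → ℂ) : Prop :=
  ∀ N, HasSum (fun M => (transProb p N M : ℂ) * x M) (y N)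

/-! ### The sequence spaces `c₀` and `c`, with the supremum norm -/

/-- The space `c₀` of complex sequences that converge to zero. -/
def c0 : Submodule ℂ (lp (fun _ : ℕ => ℂ) ∞) where
  carrier := {x | Tendsto (fun n => x n) atTop (𝓝 0)}
  add_mem' {x y} hx hy := by
    simpa using Tendsto.add (f := fun n => x n) (g := fun n => y n) hx hy
  zero_mem' := by simp
  smul_mem' a x hx := by
    simpa using Tendsto.const_mul (f := fun n => x n) a hx

/-- The space `c` of convergent complex sequences. -/
def c : Submodule ℂ (lp (fun _ : ℕ => ℂ) ∞) where
  carrier := {x | ∃ l : ℂ, Tendsto (fun n => x n) atTop (𝓝 l)}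
  add_mem' {x y} hx hy := by
    obtain ⟨a, ha⟩ := hx
    obtain ⟨b, hb⟩ := hy
    exact ⟨a + b, by simpa using ha.add hb⟩
  zero_mem' := ⟨0, by simp⟩
  smul_mem' a x hx := by
    obtain ⟨l, hl⟩ := hx
    exact ⟨a * l, by simpa using hl.const_mul a⟩

/-! ### The set `E_p` -/

/-- The map `g (x, y) = ((x - 1 + p) (y - 1 + p) / p², x)` of `ℂ²`. -/
noncomputable def g (p : ℝ) (z : ℂ × ℂ) : ℂ × ℂ :=
  ((z.1 - 1 + p) * (z.2 - 1 + p) / (p : ℂ) ^ 2, z.1)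

/-- The filled Julia set of a self-map of `ℂ²`: the points with a bounded orbit. -/
def filledJulia (f : ℂ × ℂ → ℂ × ℂ) : Set (ℂ × ℂ) :=
  {z | Bornology.IsBounded (Set.range fun n : ℕ => f^[n] z)}

/-- `qF p lam n` is the number `q_{F n}(lam)`. -/
noncomputable def qF (p : ℝ) (lam : ℂ) : ℕ → ℂ
  | 0 => (lam - (1 - p)) / p
  | 1 => ((lam - (1 - p)) / p) ^ 2
  | n + 2 => 1 / p * (qF p lam (n + 1) * qF p lam n) - (1 - p) / p

/-- The set `E_p` of all `lam` for which the sequence `q_{F n}(lam)` is bounded. -/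
def E (p : ℝ) : Set ℂ := {lam | Bornology.IsBounded (Set.range (qF p lam))}

end FibAdding

/-! For the spectrum, put `q_k = qF p lam k` and let `w N` be the product of the `q_k` over the
positions `k` of the digits `1` of `N`. The recursion, read as `p q_{k+2} + (1-p) = q_k q_{k+1}`,
says exactly that erasing one more block `01` of a carry preserves the eigenvalue equation `S w =
lam w`. Formally `w` is an eigenvector, but it need not lie in the space, so the `q_k` with `k ≥ 2m`
are replaced by `0`. The result has finite support and value `1` at `0`. Truncation spoils the
equation only at numbers all of whose digits form one erased carry of length `s ≥ m`, and there by
at most a constant times `p^s` (`transition_natWeight`). Boundedness of `q` makes the constant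
independent of `m`. Writing `p^s = √p^s √p^s`, one factor gives decay in `m`, the other a fixed `ℓ¹`
majorant, which lies in every `ℓ^α`. The truncated vectors are thus approximate eigenvectors in all
the spaces at once, and `lam - S` has no bounded inverse. For boundedness, each row
(`transition_row`) is a geometric distribution over the partial carries plus the successful
increment, so `S` is a weighted shift plus a norm-convergent series of weighted translations. The
Julia set description is an affine conjugacy (`iterate_g`). -/

namespace FibAdding

/-! ### Sparse words, their values and their multiplicative weights -/

/-- No two consecutive digits of the word are `1`. -/
def Sparse (w : List Bool) : Prop := w.IsChain fun a b => ¬(a = true ∧ b = true)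

/-- The number represented by the word `w` placed at position `i`. -/
def valueFrom : ℕ → List Bool → ℕ
  | _, [] => 0
  | i, d :: w => (if d then F i else 0) + valueFrom (i + 1) w

/-- The product of the `r k` over the positions `k` of the digits `1` of the word `w` placed at
position `i`. -/
noncomputable def weight (r : ℕ → ℂ) : ℕ → List Bool → ℂ
  | _, [] => 1
  | i, d :: w => (if d then r i else 1) * weight r (i + 1) w

/-- The product of the `r k` over the positions `k` of the digits `1` of `N`. -/
noncomputable def natWeight (r : ℕ → ℂ) (N : ℕ) : ℂ :=
  (N.zeckendorf.map fun k => r (k - 2)).prod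

/-- The Fibonacci indices of the digits `1` of the word `w` placed at position `i`. -/
def positions : ℕ → List Bool → List ℕ
  | _, [] => []
  | i, true :: w => (i + 2) :: positions (i + 1) w
  | i, false :: w => positions (i + 1) w

theorem F_add_two (i : ℕ) : F (i + 2) = F i + F (i + 1) := Nat.fib_add_two

theorem F_strictMono : StrictMono F := Nat.fib_add_two_strictMono

theorem F_mono : Monotone F := F_strictMono.monotone

theorem F_zero : F 0 = 1 := rfl

theorem F_one : F 1 = 2 := rfl

theorem F_pos (i : ℕ) : 0 < F i := Nat.fib_pos.2 (by omega)

theorem lt_F (i : ℕ) : i < F i := by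
  induction i with
  | zero => exact F_pos 0
  | succ n ih => exact lt_of_le_of_lt ih (F_strictMono (Nat.lt_succ_self n))

theorem valueFrom_eq_sum (i : ℕ) (w : List Bool) :
    valueFrom i w = ((positions i w).map Nat.fib).sum := by
  induction w generalizing i with
  | nil => rfl
  | cons d w ih => cases d <;> simp [valueFrom, positions, ih, F]

theorem weight_eq_prod (r : ℕ → ℂ) (i : ℕ) (w : List Bool) :
    weight r i w = ((positions i w).map fun k => r (k - 2)).prod := by
  induction w generalizing i with
  | nil => rfl
  | cons d w ih => cases d <;> simp [weight, positions, ih]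

theorem valueFrom_eq_finset_sum (i : ℕ) (w : List Bool) :
    valueFrom i w = ∑ k ∈ Finset.range w.length, if w.getD k false then F (i + k) else 0 := by
  induction w generalizing i with
  | nil => rfl
  | cons d w ih =>
    rw [List.length_cons, Finset.sum_range_succ', valueFrom, ih, add_comm]
    simp [add_assoc, add_comm 1]

theorem value_eq (w : List Bool) : value w = valueFrom 0 w := by
  simp [value, valueFrom_eq_finset_sum]

theorem sparse_tail {d : Bool} {w : List Bool} (h : Sparse (d :: w)) : Sparse w :=
  List.IsChain.tail h

theorem sparse_false {w : List Bool} (h : Sparse w) : Sparse (false :: w) := by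
  cases w with
  | nil => exact List.isChain_singleton _
  | cons a w => exact List.isChain_cons_cons.2 ⟨by simp, h⟩

theorem sparse_true_false {w : List Bool} (h : Sparse w) : Sparse (true :: false :: w) :=
  List.isChain_cons_cons.2 ⟨by simp, sparse_false h⟩

/-- The leading entry `a` is a sentinel: with `a = i = 0` it plays the part of the final `0` in
`List.IsZeckendorfRep`, forcing all indices to be at least `2`. -/
theorem isChain_positions (w : List Bool) : ∀ (i a : ℕ), a ≤ i → Sparse w →
    (a :: positions i w).IsChain fun a b => a + 2 ≤ b := by
  induction w using List.twoStepInduction with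
  | nil => intro i a _ _; exact List.isChain_singleton _
  | singleton d =>
    intro i a h _
    cases d
    · exact List.isChain_singleton _
    · exact List.isChain_cons_cons.2 ⟨by omega, List.isChain_singleton _⟩
  | cons_cons d e w ih1 ih2 =>
    intro i a h hw
    cases d
    · exact ih2 e (i + 1) a (by omega) (sparse_tail hw)
    · cases e
      · exact List.isChain_cons_cons.2
          ⟨by omega, ih1 (i + 2) (i + 2) le_rfl (sparse_tail (sparse_tail hw))⟩
      · exact absurd ⟨rfl, rfl⟩ (List.isChain_cons_cons.1 hw).1

theorem zeckendorf_valueFrom {w : List Bool} (hw : Sparse w) :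
    (valueFrom 0 w).zeckendorf = (positions 0 w).reverse := by
  rw [valueFrom_eq_sum, ← List.sum_reverse, ← List.map_reverse]
  apply Nat.zeckendorf_sum_fib
  have h := isChain_positions w 0 0 le_rfl hw
  rw [List.IsZeckendorfRep, ← List.reverse_cons, List.isChain_reverse]
  exact h

/-- By uniqueness of the Zeckendorf representation, the weight of a number can be read off any
sparse word for it, in particular one written by the transducer. -/
theorem natWeight_valueFrom (r : ℕ → ℂ) {w : List Bool} (hw : Sparse w) :
    natWeight r (valueFrom 0 w) = weight r 0 w := by
  rw [natWeight, zeckendorf_valueFrom hw, weight_eq_prod, List.map_reverse, List.prod_reverse]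

/-! ### The digits of a natural number -/

theorem pairwise_zeckendorf (N : ℕ) :
    (N.zeckendorf ++ [0]).Pairwise fun a b => b + 2 ≤ a := by
  have h := Nat.isZeckendorfRep_zeckendorf N
  rw [List.IsZeckendorfRep] at h
  have : Trans (fun a b : ℕ => b + 2 ≤ a) (fun a b : ℕ => b + 2 ≤ a) (fun a b : ℕ => b + 2 ≤ a) :=
    ⟨fun {a b c} h1 h2 => by omega⟩
  exact List.isChain_iff_pairwise.1 h

theorem two_le_of_mem_zeckendorf {N k : ℕ} (h : k ∈ N.zeckendorf) : 2 ≤ k := by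
  have := (List.pairwise_append.1 (pairwise_zeckendorf N)).2.2 k h 0 (by simp)
  omega

theorem fib_le_of_mem_zeckendorf {N k : ℕ} (h : k ∈ N.zeckendorf) : Nat.fib k ≤ N := by
  have := List.single_le_sum (l := N.zeckendorf.map Nat.fib) (by simp) _
    (List.mem_map_of_mem (f := Nat.fib) h)
  rwa [Nat.sum_zeckendorf_fib] at this

theorem F_le_of_digit {N i : ℕ} (h : digit N i = true) : F i ≤ N :=
  fib_le_of_mem_zeckendorf (of_decide_eq_true h)

theorem digit_eq_false {N i : ℕ} (h : N ≤ i) : digit N i = false := by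
  by_contra hd
  have h1 := F_le_of_digit (by simpa using hd)
  have := lt_F i
  omega

theorem not_digit_succ {N i : ℕ} (h : digit N i = true) : ¬ digit N (i + 1) = true := by
  intro h'
  have h1 : i + 2 ∈ N.zeckendorf := of_decide_eq_true h
  have h2 : i + 3 ∈ N.zeckendorf := of_decide_eq_true h'
  have hp := (List.pairwise_append.1 (pairwise_zeckendorf N)).1
  -- The relation is symmetrized, with equality added, so that it can be applied to two members in
  -- either order.
  have hs : Std.Symm fun a b : ℕ => a = b ∨ a + 2 ≤ b ∨ b + 2 ≤ a := ⟨fun a b h => by omega⟩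
  have hq : N.zeckendorf.Pairwise fun a b => a = b ∨ a + 2 ≤ b ∨ b + 2 ≤ a :=
    hp.imp fun h => Or.inr (Or.inr h)
  have := List.Pairwise.forall_of_forall (R := fun a b : ℕ => a = b ∨ a + 2 ≤ b ∨ b + 2 ≤ a)
    (fun x _ => Or.inl rfl) hq h1 h2
  omega

theorem sparse_digits (N : ℕ) : Sparse (digits N) := by
  rw [Sparse, digits, List.isChain_map]
  refine List.IsChain.imp (R := fun a b => b = a + 1) ?_ ?_
  · rintro a b rfl ⟨h1, h2⟩
    exact not_digit_succ h1 h2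
  · rw [List.isChain_iff_getElem]
    intro i hi
    simp

theorem valueFrom_digits (N : ℕ) : valueFrom 0 (digits N) = N := by
  have hnd : N.zeckendorf.Nodup :=
    ((List.pairwise_append.1 (pairwise_zeckendorf N)).1).imp fun h => by omega
  conv_rhs => rw [← Nat.sum_zeckendorf_fib N]
  rw [← List.sum_toFinset _ hnd, valueFrom_eq_finset_sum]
  rw [← Finset.sum_filter]
  refine Finset.sum_nbij' (fun i => i + 2) (fun k => k - 2) ?_ ?_ ?_ ?_ ?_
  · intro i hi
    simp only [digits, List.length_map, List.length_range, Finset.mem_filter,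
      Finset.mem_range] at hi
    have h2 := hi.2
    rw [List.getD_eq_getElem _ _ (by simpa using hi.1)] at h2
    simpa [digit] using h2
  · intro k hk
    rw [List.mem_toFinset] at hk
    have h2 := two_le_of_mem_zeckendorf hk
    obtain ⟨i, rfl⟩ := Nat.exists_eq_add_of_le' h2
    have h3 : F i ≤ N := fib_le_of_mem_zeckendorf hk
    have h4 := lt_F i
    simp only [digits, List.length_map, List.length_range, Finset.mem_filter,
      Finset.mem_range]
    refine ⟨by omega, ?_⟩
    rw [List.getD_eq_getElem _ _ (by simp; omega)]
    simpa [digit] using hk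
  · intro i _; simp
  · intro k hk
    rw [List.mem_toFinset] at hk
    have := two_le_of_mem_zeckendorf hk
    omega
  · intro i _; simp [F]

/-! ### Shapes of digit words and sums over paths -/

/-- The words `(01)ˢ00w` on which the transducer can run from its initial state, apart from the
first step. -/
inductive Carry : List Bool → Prop
  | base (w : List Bool) : Carry (false :: false :: w)
  | step {w : List Bool} : Carry w → Carry (false :: true :: w)

/-- The two final zeros force the run of blocks `01` to stop inside the word. -/
theorem carry_of_sparse (v : List Bool) : Sparse (v ++ [false, false]) → v.head? ≠ some true →
    Carry (v ++ [false, false]) := by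
  induction v using List.twoStepInduction with
  | nil => intro _ _; exact .base _
  | singleton d =>
    intro _ h
    cases d
    · exact .base _
    · simp at h
  | cons_cons d e v ih1 ih2 =>
    intro hs h
    cases d
    · cases e
      · exact .base _
      · refine .step (ih1 (sparse_tail (sparse_tail hs)) ?_)
        rintro hv
        cases v with
        | nil => simp at hv
        | cons a v =>
          obtain rfl : a = true := by simpa using hv
          exact (List.isChain_cons_cons.1 (sparse_tail hs)).1 ⟨rfl, rfl⟩
    · simp at h

theorem digits_cases (N : ℕ) : Carry (digits N) ∨
    (∃ u, digits N = true :: false :: false :: u) ∨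
    ∃ u, digits N = true :: false :: true :: u ∧ Carry u := by
  have hs := sparse_digits N
  obtain ⟨v, hv⟩ : ∃ v, digits N = v ++ [false, false, false] := by
    refine ⟨(List.range N).map (digit N), ?_⟩
    simp [digits, List.range_succ, digit_eq_false]
  rw [hv] at hs ⊢
  have happ (w : List Bool) : w ++ [false, false, false] = (w ++ [false]) ++ [false, false] := by
    simp
  match v, hs with
  | [], _ => exact Or.inl (.base _)
  | false :: v, hs =>
    left
    rw [happ] at hs ⊢
    exact carry_of_sparse _ hs (by simp)
  | [true], _ => exact Or.inr (Or.inl ⟨_, rfl⟩)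
  | [true, false], _ => exact Or.inr (Or.inl ⟨_, rfl⟩)
  | true :: true :: v, hs => exact absurd ⟨rfl, rfl⟩ (List.isChain_cons_cons.1 hs).1
  | true :: false :: false :: v, _ => exact Or.inr (Or.inl ⟨_, rfl⟩)
  | true :: false :: true :: v, hs =>
    refine Or.inr (Or.inr ⟨_, rfl, ?_⟩)
    have h3 := sparse_tail (sparse_tail hs)
    have h4 := sparse_tail h3
    change Sparse (v ++ _) at h4
    change Carry (v ++ _)
    rw [happ] at h4 ⊢
    refine carry_of_sparse _ h4 ?_
    intro h
    cases v with
    | nil => simp at h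
    | cons a v =>
      obtain rfl : a = true := by simpa using h
      exact (List.isChain_cons_cons.1 h3).1 ⟨rfl, rfl⟩

variable {p : ℝ}

theorem paths_T (p : ℝ) (u : List Bool) : paths p .T u = [(u, 1)] := by
  induction u with
  | nil => rw [paths]
  | cons d u ih => rw [paths, ih]; simp

/-- The expectation of `f` under a finite list of weighted outcomes. -/
noncomputable def expect {β : Type*} (l : List (β × ℝ)) (f : β → ℂ) : ℂ :=
  (l.map fun o => (o.2 : ℂ) * f o.1).sum

theorem expect_append {β : Type*} (l m : List (β × ℝ)) (f : β → ℂ) :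
    expect (l ++ m) f = expect l f + expect m f := by
  simp [expect]

theorem expect_map {β : Type*} (l : List (β × ℝ)) (φ : β → β) (a : ℝ) (f : β → ℂ) :
    expect (l.map fun o => (φ o.1, a * o.2)) f = a * expect l fun b => f (φ b) := by
  induction l with
  | nil => simp [expect]
  | cons o l ih =>
    simp only [expect, List.map_cons, List.sum_cons] at ih ⊢
    rw [ih]
    push_cast
    ring

theorem expect_congr {β : Type*} {l : List (β × ℝ)} {f f' : β → ℂ}
    (h : ∀ o ∈ l, f o.1 = f' o.1) : expect l f = expect l f' := by
  unfold expect
  congr 1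
  exact List.map_congr_left fun o ho => by rw [h o ho]

/-- The expectation over the paths of the transducer from its initial state. -/
noncomputable def pathSum (p : ℝ) (u : List Bool) (f : List Bool → ℂ) : ℂ :=
  expect (paths p .I u) f

theorem pathSum_00 (u : List Bool) (f : List Bool → ℂ) :
    pathSum p (false :: false :: u) f =
      p * f (true :: false :: u) + (1 - p) * f (false :: false :: u) := by
  rw [pathSum, paths]
  simp [expect, paths_T]

theorem pathSum_01 (u : List Bool) (f : List Bool → ℂ) :
    pathSum p (false :: true :: u) f =
      p * pathSum p u (fun o => f (false :: false :: o)) + (1 - p) * f (false :: true :: u) := by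
  rw [pathSum, paths, expect_append, expect_map _ (fun o => false :: false :: o)]
  simp [expect, paths_T, pathSum]

theorem pathSum_100 (u : List Bool) (f : List Bool → ℂ) :
    pathSum p (true :: false :: false :: u) f =
      p * f (false :: true :: false :: u) + (1 - p) * f (true :: false :: false :: u) := by
  rw [pathSum, paths]
  simp [expect, paths_T]

theorem pathSum_101 (u : List Bool) (f : List Bool → ℂ) :
    pathSum p (true :: false :: true :: u) f =
      p * pathSum p u (fun o => f (false :: false :: false :: o)) +
        (1 - p) * f (true :: false :: true :: u) := by
  rw [pathSum, paths, expect_append, expect_map _ (fun o => false :: false :: false :: o)]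
  simp [expect, paths_T, pathSum]

/-- Erasure writes only zeros, and the final increment puts its `1` before a `0`, so no adjacent
ones arise. -/
theorem sparse_of_mem_paths_carry {u : List Bool} (hu : Carry u) :
    Sparse u → ∀ o ∈ paths p .I u, Sparse o.1 := by
  induction hu with
  | base w =>
    intro hs o ho
    rw [paths] at ho
    simp only [paths_T, List.map_cons, List.map_nil, List.mem_append, List.mem_singleton] at ho
    have hw := sparse_tail (sparse_tail hs)
    obtain rfl | rfl := ho
    · exact sparse_true_false hw
    · exact hs
  | step hw ih =>
    intro hs o ho
    rw [paths] at ho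
    simp only [paths_T, List.map_cons, List.map_nil, List.mem_append, List.mem_singleton,
      List.mem_map] at ho
    obtain ⟨o, ho, rfl⟩ | rfl := ho
    · exact sparse_false (sparse_false (ih (sparse_tail (sparse_tail hs)) o ho))
    · exact hs

theorem sparse_of_mem_paths_digits {N : ℕ} : ∀ o ∈ paths p .I (digits N), Sparse o.1 := by
  have hs := sparse_digits N
  obtain h | ⟨u, hu⟩ | ⟨u, hu, h⟩ := digits_cases N
  · exact sparse_of_mem_paths_carry h hs
  · rw [hu] at hs ⊢
    intro o ho
    rw [paths] at ho
    simp only [paths_T, List.map_cons, List.map_nil, List.mem_append, List.mem_singleton] at ho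
    have hw := sparse_tail (sparse_tail (sparse_tail hs))
    obtain rfl | rfl := ho
    · exact sparse_false (sparse_true_false hw)
    · exact hs
  · rw [hu] at hs ⊢
    intro o ho
    rw [paths] at ho
    simp only [paths_T, List.map_cons, List.map_nil, List.mem_append, List.mem_singleton,
      List.mem_map] at ho
    have hw := sparse_tail (sparse_tail (sparse_tail hs))
    obtain ⟨o, ho, rfl⟩ | rfl := ho
    · exact sparse_false (sparse_false (sparse_false (sparse_of_mem_paths_carry h hw o ho)))
    · exact hs

/-- The transition matrix applied to the sequence `x`. -/
noncomputable def transition (p : ℝ) (x : ℕ → ℂ) (N : ℕ) : ℂ :=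
  pathSum p (digits N) fun o => x (valueFrom 0 o)

/-- There are finitely many paths; the sum over targets regroups them by the number they write. -/
theorem isTransition_transition (p : ℝ) (x : ℕ → ℂ) : IsTransition p x (transition p x) := by
  intro N
  simp only [transProb, transition, pathSum]
  induction paths p .I (digits N) with
  | nil => simp [expect]
  | cons o l ih =>
    simp only [expect, List.map_cons, List.sum_cons, ← value_eq] at ih ⊢
    have h1 : HasSum (fun M => if M = value o.1 then (o.2 : ℂ) * x (value o.1) else 0)
        ((o.2 : ℂ) * x (value o.1)) := hasSum_ite_eq _ _
    convert h1.add ih using 1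
    ext M
    rw [Complex.ofReal_add, add_mul]
    congr 1
    by_cases h : value o.1 = M
    · subst h; simp
    · simp [h, Ne.symm h]

/-! ### The rows of the transition matrix -/

/-- The number represented by the lowest `j` digits `1` that a carry erases: digits at
odd positions if `e` is `false`, at even positions if `e` is `true`. -/
def erased (e : Bool) (j : ℕ) : ℕ :=
  if e then (if j = 0 then 0 else F (2 * j + 1) - 1) else F (2 * j) - 1

/-- Stopping after `j` blocks `01` has probability `(1-p) p^j` and removes `F (i+1) + F (i+3) + ...
+ F (i+2j-1) = F (i+2j) - F i`. Erasing all `s` blocks and then writing `1` at position `i+2s` has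
probability `p^(s+1)` and adds `F i` in total. The inequalities make the truncated subtractions
genuine. -/
theorem pathSum_carry {u : List Bool} (hu : Carry u) : ∀ i : ℕ, ∃ s : ℕ,
    (∀ j ≤ s, F (i + 2 * j) - F i ≤ valueFrom i u) ∧
    ∀ f : ℕ → ℂ, pathSum p u (fun o => f (valueFrom i o)) =
      ∑ j ∈ Finset.range (s + 1), (1 - p) * p ^ j * f (valueFrom i u - (F (i + 2 * j) - F i)) +
        p ^ (s + 1) * f (valueFrom i u + F i) := by
  induction hu with
  | base w =>
    intro i
    refine ⟨0, ?_, ?_⟩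
    · intro j hj
      obtain rfl : j = 0 := by omega
      simp
    · intro f
      rw [pathSum_00]
      simp [valueFrom, add_comm]
  | @step w hw ih =>
    intro i
    obtain ⟨s, hs, hf⟩ := ih (i + 2)
    have hv : valueFrom i (false :: true :: w) = F (i + 1) + valueFrom (i + 2) w := by
      simp [valueFrom, add_assoc]
    have h2 := F_add_two i
    have hle (j : ℕ) : F (i + 2) ≤ F (i + 2 + 2 * j) := F_mono (by omega)
    have hidx (j : ℕ) : i + 2 * (j + 1) = i + 2 + 2 * j := by ring
    refine ⟨s + 1, ?_, ?_⟩
    · intro j hj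
      cases j with
      | zero => simp
      | succ j =>
        have h3 := hs j (by omega)
        have h4 := hle j
        rw [hidx, hv]
        omega
    · intro f
      rw [pathSum_01, Finset.sum_range_succ']
      have h5 : (fun o => f (valueFrom i (false :: false :: o))) =
          fun o => f (valueFrom (i + 2) o) := by
        ext o; simp [valueFrom, add_assoc]
      rw [h5, hf, hv, mul_add, Finset.mul_sum]
      have h6 : ∀ j ∈ Finset.range (s + 1),
          (p : ℂ) * ((1 - p) * p ^ j *
            f (valueFrom (i + 2) w - (F (i + 2 + 2 * j) - F (i + 2)))) =
          (1 - p) * p ^ (j + 1) *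
            f (F (i + 1) + valueFrom (i + 2) w - (F (i + 2 * (j + 1)) - F i)) := by
        intro j hj
        have h3 := hs j (by simpa [Nat.lt_succ_iff] using hj)
        have h4 := hle j
        rw [hidx, show F (i + 1) + valueFrom (i + 2) w - (F (i + 2 + 2 * j) - F i) =
          valueFrom (i + 2) w - (F (i + 2 + 2 * j) - F (i + 2)) by omega]
        ring
      rw [Finset.sum_congr rfl h6, show valueFrom (i + 2) w + F (i + 2) =
        F (i + 1) + valueFrom (i + 2) w + F i by omega]
      simp
      ring

/-- A word beginning with `0` is a carry at position `0`, one beginning with `100` only trades `F 0`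
for `F 1`, and `101` first erases `F 0 + F 2 = F 3 - 1` and carries on at position `3`. The separate
value of `erased true 0` is needed because `F 1 - 1` is `1`, not `0`. -/
theorem transition_row (p : ℝ) (N : ℕ) : ∃ (e : Bool) (s : ℕ), (∀ j ≤ s, erased e j ≤ N) ∧
    ∀ x : ℕ → ℂ, transition p x N =
      ∑ j ∈ Finset.range (s + 1), (1 - p) * p ^ j * x (N - erased e j) +
        p ^ (s + 1) * x (N + 1) := by
  have hN := valueFrom_digits N
  unfold transition
  obtain h | ⟨u, hu⟩ | ⟨u, hu, h⟩ := digits_cases N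
  · obtain ⟨s, hs, hf⟩ := pathSum_carry (p := p) h 0
    refine ⟨false, s, ?_, ?_⟩
    · intro j hj
      simpa [erased, hN, F_zero] using hs j hj
    · intro x
      rw [hf, hN]
      simp [erased, F_zero]
  · rw [hu] at hN ⊢
    refine ⟨true, 0, ?_, ?_⟩
    · intro j hj
      obtain rfl : j = 0 := by omega
      simp [erased]
    · intro x
      rw [pathSum_100, hN, ← hN]
      simp [erased, valueFrom, F_zero, F_one]
      ring_nf
  · rw [hu] at hN ⊢
    obtain ⟨s, hs, hf⟩ := pathSum_carry (p := p) h 3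
    have hv : N = 4 + valueFrom 3 u := by
      rw [← hN]
      simp [valueFrom, F, show Nat.fib 4 = 3 from rfl]
      ring
    have hidx (j : ℕ) : 2 * (j + 1) + 1 = 3 + 2 * j := by ring
    have hF : F 3 = 5 := rfl
    have hle (j : ℕ) : F 3 ≤ F (3 + 2 * j) := F_mono (by omega)
    refine ⟨true, s + 1, ?_, ?_⟩
    · intro j hj
      cases j with
      | zero => simp [erased]
      | succ j =>
        have h3 := hs j (by omega)
        have h4 := hle j
        simp only [erased, hidx]
        simp
        omega
    · intro x
      rw [pathSum_101, Finset.sum_range_succ']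
      have h5 : (fun o => x (valueFrom 0 (false :: false :: false :: o))) =
          fun o => x (valueFrom 3 o) := by
        ext o; simp [valueFrom]
      rw [h5, hf, hN, mul_add, Finset.mul_sum]
      have h6 : ∀ j ∈ Finset.range (s + 1),
          (p : ℂ) * ((1 - p) * p ^ j * x (valueFrom 3 u - (F (3 + 2 * j) - F 3))) =
          (1 - p) * p ^ (j + 1) * x (N - erased true (j + 1)) := by
        intro j hj
        have h3 := hs j (by simpa [Nat.lt_succ_iff] using hj)
        have h4 := hle j
        have h7 : N - erased true (j + 1) = valueFrom 3 u - (F (3 + 2 * j) - F 3) := by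
          simp only [erased, hidx]
          simp
          omega
        rw [h7]
        ring
      rw [Finset.sum_congr rfl h6, show valueFrom 3 u + F 3 = N + 1 by omega]
      simp [erased]
      ring

/-! ### Approximate eigenvectors -/

/-- Beyond the truncation, only words without a digit `1` have nonzero weight. -/
theorem weight_eq_zero_or {r : ℕ → ℂ} (w : List Bool) : ∀ {i : ℕ}, (∀ k, i ≤ k → r k = 0) →
    weight r i w = 0 ∨ (weight r i w = 1 ∧ valueFrom i w = 0) := by
  induction w with
  | nil => intro i _; exact Or.inr ⟨rfl, rfl⟩
  | cons d w ih =>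
    intro i hr
    cases d
    · simpa [weight, valueFrom] using ih (i := i + 1) fun k hk => hr k (by omega)
    · left
      simp [weight, hr i le_rfl]

/-- For a carry word at position `i`, the products `weight r` satisfy the eigenvalue equation
up to an error that occurs only at the word all of whose digits are erased. -/
theorem pathSum_weight_carry {r : ℕ → ℂ} {n : ℕ} {D : ℝ} (hp0 : 0 ≤ p)
    (hr : ∀ k, n ≤ k → r k = 0)
    (hd : ∀ i, i + 2 < n → p * r (i + 2) + (1 - p) - r i * r (i + 1) = 0)
    (hD : ∀ i, ‖p * r (i + 2) + (1 - p) - r i * r (i + 1)‖ ≤ D)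
    {u : List Bool} (hu : Carry u) : ∀ i : ℕ,
    pathSum p u (weight r i) - (p * r i + (1 - p)) * weight r i u = 0 ∨
    ∃ s : ℕ, n ≤ i + 2 * s ∧ valueFrom i u = F (i + 2 * s) - F i ∧
      ‖pathSum p u (weight r i) - (p * r i + (1 - p)) * weight r i u‖ ≤ p ^ s * D := by
  induction hu with
  | base w =>
    intro i
    left
    rw [pathSum_00]
    simp [weight]
    ring
  | @step w hw ih =>
    intro i
    -- The error for `01w` is `p` times the error for `w`, plus `p` times the defect of the
    -- recursion times the weight of `w`.
    have hE : pathSum p (false :: true :: w) (weight r i) -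
        (p * r i + (1 - p)) * weight r i (false :: true :: w) =
        p * (pathSum p w (weight r (i + 2)) - (p * r (i + 2) + (1 - p)) * weight r (i + 2) w) +
        p * (p * r (i + 2) + (1 - p) - r i * r (i + 1)) * weight r (i + 2) w := by
      rw [pathSum_01]
      simp [weight, add_assoc]
      ring
    have h2 := F_add_two i
    have hv : valueFrom i (false :: true :: w) = F (i + 1) + valueFrom (i + 2) w := by
      simp [valueFrom, add_assoc]
    have hrec : (p * r (i + 2) + (1 - p) - r i * r (i + 1)) * weight r (i + 2) w = 0 →
        pathSum p (false :: true :: w) (weight r i) -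
          (p * r i + (1 - p)) * weight r i (false :: true :: w) = 0 ∨
        ∃ s : ℕ, n ≤ i + 2 * s ∧ valueFrom i (false :: true :: w) = F (i + 2 * s) - F i ∧
          ‖pathSum p (false :: true :: w) (weight r i) -
            (p * r i + (1 - p)) * weight r i (false :: true :: w)‖ ≤ p ^ s * D := by
      intro h0
      rw [hE, mul_assoc (p : ℂ), h0, mul_zero, add_zero]
      obtain h | ⟨s, h3, h4, h5⟩ := ih (i + 2)
      · left; rw [h, mul_zero]
      · right
        have hle : F (i + 2) ≤ F (i + 2 + 2 * s) := F_mono (by omega)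
        refine ⟨s + 1, by omega, ?_, ?_⟩
        · rw [hv, h4, show i + 2 * (s + 1) = i + 2 + 2 * s by ring]
          omega
        · rw [norm_mul, Complex.norm_real, Real.norm_of_nonneg hp0, pow_succ' p s, mul_assoc]
          exact mul_le_mul_of_nonneg_left h5 hp0
    -- Below the truncation the defect vanishes. Beyond it the defect counts only if the remainder
    -- has value `0`, so that the present block is the last one and `s = 1`.
    by_cases hi : i + 2 < n
    · exact hrec (by rw [hd i hi, zero_mul])
    · have hr' : ∀ k, i + 2 ≤ k → r k = 0 := fun k hk => hr k (by omega)
      obtain h0 | ⟨h1, hv0⟩ := weight_eq_zero_or w hr'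
      · exact hrec (by rw [h0, mul_zero])
      · cases hw with
        | base w' =>
          right
          refine ⟨1, by omega, ?_, ?_⟩
          · rw [hv, hv0, show i + 2 * 1 = i + 2 by ring]
            omega
          · rw [hE, h1, pathSum_00]
            have h3 : weight r (i + 2) (false :: false :: w') = weight r (i + 4) w' := by
              simp [weight]
            rw [h3] at h1
            have h4 : weight r (i + 2) (true :: false :: w') = 0 := by
              simp [weight, hr' (i + 2) le_rfl]
            rw [h3, h1, h4, hr' (i + 2) le_rfl]
            have h5 := hD i
            rw [hr' (i + 2) le_rfl] at h5
            have : (p : ℂ) * (p * 0 + (1 - p) * 1 - (p * 0 + (1 - p)) * 1) +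
              p * (p * 0 + (1 - p) - r i * r (i + 1)) * 1 =
              p * (p * 0 + (1 - p) - r i * r (i + 1)) := by ring
            rw [this, norm_mul, Complex.norm_real, Real.norm_of_nonneg hp0, pow_one]
            exact mul_le_mul_of_nonneg_left h5 hp0
        | @step w' hw' =>
          -- A further block would have a digit `1` at `i + 3`, where `r` vanishes, contradicting
          -- weight `1`.
          rw [weight, weight] at h1
          simp [hr' (i + 2 + 1) (by omega)] at h1

/-- For words `100...` the error is a multiple of `r 1 - r 0 ^ 2`. For `101u`, this relation and the
recursion at index `1`, valid since `m ≥ 2`, reduce the error to `p` times that of the carry `u` at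
position `3`. -/
theorem transition_natWeight {r : ℕ → ℂ} {m : ℕ} {D : ℝ} (hp0 : 0 ≤ p) (hm : 2 ≤ m)
    (hr : ∀ k, 2 * m ≤ k → r k = 0) (hr1 : r 1 = r 0 ^ 2)
    (hd : ∀ i, i + 2 < 2 * m → p * r (i + 2) + (1 - p) - r i * r (i + 1) = 0)
    (hD : ∀ i, ‖p * r (i + 2) + (1 - p) - r i * r (i + 1)‖ ≤ D) (N : ℕ) :
    transition p (natWeight r) N - (p * r 0 + (1 - p)) * natWeight r N = 0 ∨
    ∃ (e : Bool) (s : ℕ), m ≤ s ∧ N = erased e s ∧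
      ‖transition p (natWeight r) N - (p * r 0 + (1 - p)) * natWeight r N‖ ≤ p ^ s * D := by
  have hN := valueFrom_digits N
  have hT : transition p (natWeight r) N = pathSum p (digits N) (weight r 0) := by
    rw [transition, pathSum, pathSum]
    exact expect_congr fun o ho => natWeight_valueFrom r (sparse_of_mem_paths_digits o ho)
  have hW : natWeight r N = weight r 0 (digits N) := by
    conv_lhs => rw [← hN]
    exact natWeight_valueFrom r (sparse_digits N)
  rw [hT, hW]
  obtain h | ⟨u, hu⟩ | ⟨u, hu, h⟩ := digits_cases N
  · obtain h0 | ⟨s, h1, h2, h3⟩ := pathSum_weight_carry hp0 hr hd hD h 0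
    · exact Or.inl h0
    · refine Or.inr ⟨false, s, by omega, ?_, h3⟩
      rw [hN] at h2
      simpa [erased, F_zero] using h2
  · left
    rw [hu, pathSum_100]
    simp [weight, hr1]
    ring
  · have hE : pathSum p (digits N) (weight r 0) - (p * r 0 + (1 - p)) * weight r 0 (digits N) =
        p * (pathSum p u (weight r 3) - (p * r 3 + (1 - p)) * weight r 3 u) := by
      have h1 := hd 0 (by omega)
      have h2 := hd 1 (by omega)
      norm_num at h1 h2
      rw [hu, pathSum_101]
      simp [weight]
      linear_combination (p * weight r 3 u) * h2 + (p * weight r 3 u * r 2) * hr1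
    rw [hE]
    obtain h0 | ⟨s, h1, h2, h3⟩ := pathSum_weight_carry hp0 hr hd hD h 3
    · left; rw [h0, mul_zero]
    · right
      refine ⟨true, s + 1, by omega, ?_, ?_⟩
      · rw [hu] at hN
        have hle : F 3 ≤ F (3 + 2 * s) := F_mono (by omega)
        have hF : F 3 = 5 := rfl
        have hv : N = 4 + valueFrom 3 u := by
          rw [← hN]
          simp [valueFrom, F, show Nat.fib 4 = 3 from rfl]
          ring
        rw [hv, h2]
        simp only [erased, show 2 * (s + 1) + 1 = 3 + 2 * s by ring]
        simp
        omega
      · rw [norm_mul, Complex.norm_real, Real.norm_of_nonneg hp0, pow_succ' p s, mul_assoc]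
        exact mul_le_mul_of_nonneg_left h3 hp0

/-! ### The transition operator on the sequence spaces -/

/-- Weighted composition operators with bounded weights and injective symbol are bounded
on `ℓ^α`. -/
theorem exists_weighted_comp (α : ℝ≥0∞) [hα : Fact (1 ≤ α)] (c : ℕ → ℂ) (φ : ℕ → ℕ) {K : ℝ}
    (hK : 0 ≤ K) (hc : ∀ N, ‖c N‖ ≤ K) (hφ : Set.InjOn φ {N | c N ≠ 0}) :
    ∃ T : lp (fun _ : ℕ => ℂ) α →L[ℂ] lp (fun _ : ℕ => ℂ) α,
      ‖T‖ ≤ K ∧ ∀ x N, T x N = c N * x (φ N) := by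
  have hα0 : α ≠ 0 := (zero_lt_one.trans_le hα.out).ne'
  have hpt (x : lp (fun _ : ℕ => ℂ) α) (N : ℕ) : ‖c N * x (φ N)‖ ≤ K * ‖x‖ := by
    rw [norm_mul]
    exact mul_le_mul (hc N) (lp.norm_apply_le_norm hα0 x _) (norm_nonneg _) hK
  have hsum (x : lp (fun _ : ℕ => ℂ) α) (h : 0 < α.toReal) (t : Finset ℕ) :
      ∑ N ∈ t, ‖c N * x (φ N)‖ ^ α.toReal ≤ (K * ‖x‖) ^ α.toReal := by
    classical
    have h1 : ∑ N ∈ t, ‖c N * x (φ N)‖ ^ α.toReal =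
        ∑ N ∈ t.filter (fun N => c N ≠ 0), ‖c N * x (φ N)‖ ^ α.toReal := by
      symm
      refine Finset.sum_filter_of_ne fun N _ hN => ?_
      rintro h0
      simp [h0, Real.zero_rpow h.ne'] at hN
    have h2 : Set.InjOn φ (t.filter fun N => c N ≠ 0 : Finset ℕ) :=
      hφ.mono fun N hN => by simpa using (Finset.mem_filter.1 hN).2
    calc ∑ N ∈ t, ‖c N * x (φ N)‖ ^ α.toReal
        ≤ ∑ N ∈ t.filter (fun N => c N ≠ 0), K ^ α.toReal * ‖x (φ N)‖ ^ α.toReal := by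
          rw [h1]
          refine Finset.sum_le_sum fun N _ => ?_
          rw [← Real.mul_rpow hK (norm_nonneg _), norm_mul]
          exact Real.rpow_le_rpow (by positivity)
            (mul_le_mul_of_nonneg_right (hc N) (norm_nonneg _)) h.le
      _ = K ^ α.toReal * ∑ M ∈ (t.filter fun N => c N ≠ 0).image φ, ‖x M‖ ^ α.toReal := by
          rw [← Finset.mul_sum, Finset.sum_image h2]
      _ ≤ K ^ α.toReal * ‖x‖ ^ α.toReal :=
          mul_le_mul_of_nonneg_left (lp.sum_rpow_le_norm_rpow h x _) (Real.rpow_nonneg hK _)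
      _ = (K * ‖x‖) ^ α.toReal := (Real.mul_rpow hK (norm_nonneg _)).symm
  have hmem (x : lp (fun _ : ℕ => ℂ) α) : Memℓp (fun N => c N * x (φ N)) α := by
    obtain h | h | h := α.trichotomy
    · exact absurd h hα0
    · subst h
      exact memℓp_infty ⟨K * ‖x‖, by rintro _ ⟨N, rfl⟩; exact hpt x N⟩
    · exact memℓp_gen' (hsum x h)
  let T₀ : lp (fun _ : ℕ => ℂ) α →ₗ[ℂ] lp (fun _ : ℕ => ℂ) α :=
    { toFun := fun x => ⟨fun N => c N * x (φ N), hmem x⟩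
      map_add' := fun x y => by
        ext N
        simp only [lp.coeFn_add, Pi.add_apply, mul_add]
      map_smul' := fun a x => by
        ext N
        simp
        ring }
  have hT₀ (x : lp (fun _ : ℕ => ℂ) α) (N : ℕ) : T₀ x N = c N * x (φ N) := rfl
  have hbound (x : lp (fun _ : ℕ => ℂ) α) : ‖T₀ x‖ ≤ K * ‖x‖ := by
    obtain h | h | h := α.trichotomy
    · exact absurd h hα0
    · subst h
      exact lp.norm_le_of_forall_le (by positivity) (hpt x)
    · exact lp.norm_le_of_forall_sum_le h (by positivity) (hsum x h)
  exact ⟨T₀.mkContinuous K hbound, T₀.mkContinuous_norm_le hK hbound, hT₀⟩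

/-- The partial carries are sorted by parity and length `(e, j)`, each giving one weighted
translation. Its coefficient vanishes where `N < erased e j`, so truncated subtraction is injective
on the support. -/
theorem exists_transition_expansion (hp0 : 0 < p) (hp1 : p < 1) :
    ∃ (a : ℕ → ℂ) (c : Bool × ℕ → ℕ → ℂ), (∀ N, ‖a N‖ ≤ 1) ∧ (∀ k N, ‖c k N‖ ≤ p ^ k.2) ∧
      (∀ k N, c k N ≠ 0 → erased k.1 k.2 ≤ N) ∧
      ∀ x N, HasSum (fun k => c k N * x (N - erased k.1 k.2))
        (transition p x N - a N * x (N + 1)) := by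
  choose e s hs hrow using transition_row p
  refine ⟨fun N => p ^ (s N + 1),
    fun k N => (if k.1 = e N ∧ k.2 ≤ s N then (1 - p) * p ^ k.2 else 0 : ℂ), ?_, ?_, ?_, ?_⟩
  · intro N
    rw [norm_pow, Complex.norm_real, Real.norm_of_nonneg hp0.le]
    exact pow_le_one₀ hp0.le hp1.le
  · intro k N
    dsimp only
    split_ifs
    · rw [norm_mul, norm_pow, Complex.norm_real, Real.norm_of_nonneg hp0.le, ← Complex.ofReal_one,
        ← Complex.ofReal_sub, Complex.norm_real, Real.norm_of_nonneg (by linarith)]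
      exact mul_le_of_le_one_left (by positivity) (by linarith)
    · simp only [norm_zero]
      positivity
  · intro k N h
    simp only [ne_eq, ite_eq_right_iff, not_forall] at h
    obtain ⟨⟨h1, h2⟩, _⟩ := h
    rw [h1]
    exact hs N _ h2
  · intro x N
    rw [hrow, add_sub_cancel_right]
    have h := hasSum_sum_of_ne_finset_zero (L := SummationFilter.unconditional _)
      (f := fun k : Bool × ℕ =>
      (if k.1 = e N ∧ k.2 ≤ s N then (1 - p) * p ^ k.2 else 0 : ℂ) * x (N - erased k.1 k.2))
      (s := {e N} ×ˢ Finset.range (s N + 1)) (by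
        rintro ⟨b, j⟩ hk
        simp only [Finset.mem_product, Finset.mem_singleton, Finset.mem_range,
          Nat.lt_succ_iff] at hk
        simp [hk])
    rw [Finset.sum_product, Finset.sum_singleton] at h
    convert h using 1
    refine Finset.sum_congr rfl fun j hj => ?_
    have : j ≤ s N := by simpa [Nat.lt_succ_iff] using hj
    simp [this]

theorem summable_weights (hp0 : 0 < p) (hp1 : p < 1) : Summable fun k : Bool × ℕ => p ^ k.2 := by
  have h := Summable.mul_of_nonneg (f := fun _ : Bool => (1 : ℝ)) (g := fun j : ℕ => p ^ j)
    (Summable.of_finite) (summable_geometric_of_lt_one hp0.le hp1) (fun _ => zero_le_one)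
    (fun j => by positivity)
  simpa using h

/-- The translation indexed by `(e, j)` has norm at most `p^j` on every `ℓ^α`, so the series
converges in operator norm. -/
theorem exists_transition_operator (hp0 : 0 < p) (hp1 : p < 1) (α : ℝ≥0∞) [hα : Fact (1 ≤ α)] :
    ∃ S : lp (fun _ : ℕ => ℂ) α →L[ℂ] lp (fun _ : ℕ => ℂ) α,
      ∀ x N, S x N = transition p x N := by
  obtain ⟨a, c, ha, hc, hcs, hsum⟩ := exists_transition_expansion hp0 hp1
  obtain ⟨A, -, hA⟩ := exists_weighted_comp α a (fun N => N + 1) zero_le_one ha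
    (fun _ _ _ _ h => by simpa using h)
  have hT (k : Bool × ℕ) := exists_weighted_comp α (c k) (fun N => N - erased k.1 k.2)
    (by positivity) (hc k) (fun N hN M hM h => by
      have h1 := hcs k N hN
      have h2 := hcs k M hM
      dsimp only at h
      omega)
  choose T hTn hTa using hT
  have hTs : Summable T := Summable.of_norm_bounded (summable_weights hp0 hp1) hTn
  refine ⟨A + ∑' k, T k, fun x N => ?_⟩
  have h1 : HasSum (fun k => T k x N) ((∑' k, T k) x N) :=
    (hTs.hasSum.mapL (ContinuousLinearMap.apply ℂ (lp (fun _ : ℕ => ℂ) α) x)).mapL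
      (lp.evalCLM ℂ (fun _ : ℕ => ℂ) α N)
  have h2 := hsum x N
  simp only [hTa] at h1
  have h3 := h1.unique h2
  change A x N + (∑' k, T k) x N = _
  rw [h3, hA]
  ring

theorem tendsto_bounded_mul_zero {a x : ℕ → ℂ} {K : ℝ} (ha : ∀ N, ‖a N‖ ≤ K)
    (hx : Tendsto x atTop (𝓝 0)) : Tendsto (fun N => a N * x N) atTop (𝓝 0) := by
  refine squeeze_zero_norm (a := fun N => K * ‖x N‖) (fun N => ?_) ?_
  · rw [norm_mul]
    exact mul_le_mul_of_nonneg_right (ha N) (norm_nonneg _)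
  · simpa using hx.norm.const_mul K

/-- Dominated convergence: each translation of a null sequence is null, and the terms are dominated
by `C p^j`. -/
theorem tendsto_transition_zero (hp0 : 0 < p) (hp1 : p < 1) {x : ℕ → ℂ}
    (hx : Tendsto x atTop (𝓝 0)) : Tendsto (transition p x) atTop (𝓝 0) := by
  obtain ⟨a, c, ha, hc, hcs, hsum⟩ := exists_transition_expansion hp0 hp1
  obtain ⟨C, hC⟩ := (Metric.isBounded_range_of_tendsto x hx).exists_norm_le
  have hC' (M : ℕ) : ‖x M‖ ≤ C := hC _ ⟨M, rfl⟩
  have h1 : Tendsto (fun N => ∑' k, c k N * x (N - erased k.1 k.2)) atTop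
      (𝓝 (∑' _ : Bool × ℕ, (0 : ℂ))) := by
    refine tendsto_tsum_of_dominated_convergence
      ((summable_weights hp0 hp1).mul_right C) ?_ (Eventually.of_forall fun N k => ?_)
    · intro k
      exact tendsto_bounded_mul_zero (hc k) (hx.comp (tendsto_sub_atTop_nat _))
    · rw [norm_mul]
      exact mul_le_mul (hc k N) (hC' _) (norm_nonneg _) (by positivity)
  have h2 : Tendsto (fun N => a N * x (N + 1)) atTop (𝓝 0) :=
    tendsto_bounded_mul_zero ha (hx.comp (tendsto_add_atTop_nat 1))
  have h3 := h1.add h2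
  rw [tsum_zero, zero_add] at h3
  refine h3.congr fun N => ?_
  rw [(hsum x N).tsum_eq]
  ring

/-- Every row sums to `1`, by the geometric sum. -/
theorem transition_sub_const (p : ℝ) (x : ℕ → ℂ) (l : ℂ) (N : ℕ) :
    transition p (fun M => x M - l) N = transition p x N - l := by
  obtain ⟨e, s, -, h⟩ := transition_row p N
  have hg := mul_neg_geom_sum (p : ℂ) (s + 1)
  rw [h, h]
  simp only [mul_sub, Finset.sum_sub_distrib]
  rw [← Finset.sum_mul, ← Finset.mul_sum, hg]
  ring

theorem tendsto_transition (hp0 : 0 < p) (hp1 : p < 1) {x : ℕ → ℂ} {l : ℂ}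
    (hx : Tendsto x atTop (𝓝 l)) : Tendsto (transition p x) atTop (𝓝 l) := by
  have h := tendsto_transition_zero hp0 hp1 (tendsto_sub_nhds_zero_iff.2 hx)
  exact tendsto_sub_nhds_zero_iff.1 (h.congr fun N => transition_sub_const p x l N)

/-! ### The spectrum -/

theorem erased_injective (e : Bool) : Function.Injective (erased e) := by
  refine StrictMono.injective (strictMono_nat_of_lt_succ fun j => ?_)
  cases e
  · have h1 := F_pos (2 * j)
    have h2 : F (2 * j) < F (2 * (j + 1)) := F_strictMono (by omega)
    simp [erased]
    omega
  · have h1 : F 1 ≤ F (2 * j + 1) := F_mono (by omega)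
    have h2 : F (2 * j + 1) < F (2 * (j + 1) + 1) := F_strictMono (by omega)
    rw [F_one] at h1
    by_cases hj : j = 0
    · subst hj
      simp only [erased, if_true, Nat.add_one_ne_zero, if_false]
      omega
    · simp only [erased, if_true, hj, Nat.add_one_ne_zero, if_false]
      omega

theorem finite_support_natWeight {r : ℕ → ℂ} {n : ℕ} (hr : ∀ k, n ≤ k → r k = 0) :
    (Function.support (natWeight r)).Finite := by
  refine Set.Finite.subset (Set.finite_lt_nat (Nat.fib (n + 2))) fun N hN => ?_
  have hlt : ∀ k ∈ N.zeckendorf, k < n + 2 := by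
    intro k hk
    by_contra hkn
    apply hN
    rw [natWeight]
    exact List.prod_eq_zero (List.mem_map.2 ⟨k, hk, hr _ (by omega)⟩)
  have h := (Nat.isZeckendorfRep_zeckendorf N).sum_fib_lt (n := n + 2) (by
    intro k hk
    have := List.mem_of_mem_head? hk
    simp only [List.mem_append, List.mem_singleton] at this
    obtain h | rfl := this
    · exact hlt k h
    · omega)
  rwa [Nat.sum_zeckendorf_fib] at h

/-- The majorant `B` carries `√p^s` at the exceptional numbers `erased e s`; it depends neither on
`lam` nor on the truncation `m`. -/
theorem exists_approx_eigenvectors (hp0 : 0 < p) (hp1 : p < 1) :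
    ∃ B : ℕ → ℝ, Summable B ∧ (∀ N, 0 ≤ B N) ∧ ∀ lam ∈ E p, ∃ D : ℝ, 0 ≤ D ∧ ∀ m, 2 ≤ m →
      ∃ w : ℕ → ℂ, (Function.support w).Finite ∧ w 0 = 1 ∧
        ∀ N, ‖transition p w N - lam * w N‖ ≤ D * √p ^ m * B N := by
  have hpc : (p : ℂ) ≠ 0 := by exact_mod_cast hp0.ne'
  have hq0 : 0 ≤ √p := Real.sqrt_nonneg p
  have hq1 : √p < 1 := by rw [Real.sqrt_lt' one_pos]; simpa using hp1
  let b (e : Bool) : ℕ → ℝ := Function.extend (erased e) (fun s => √p ^ s) 0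
  have hb (e : Bool) (s : ℕ) : b e (erased e s) = √p ^ s := (erased_injective e).extend_apply _ _ s
  have hb0 (e : Bool) (N : ℕ) : 0 ≤ b e N := by
    by_cases h : ∃ s, erased e s = N
    · obtain ⟨s, rfl⟩ := h
      rw [hb]
      positivity
    · have h0 : b e N = 0 := Function.extend_apply' _ _ _ h
      exact h0.ge
  have hbs (e : Bool) : Summable (b e) :=
    (summable_extend_zero (erased_injective e)).2 (summable_geometric_of_lt_one hq0 hq1)
  refine ⟨fun N => b false N + b true N, (hbs false).add (hbs true),
    fun N => add_nonneg (hb0 _ N) (hb0 _ N), fun lam hlam => ?_⟩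
  obtain ⟨Q, hQ⟩ := Bornology.IsBounded.exists_norm_le
    (show Bornology.IsBounded (Set.range (qF p lam)) from hlam)
  have hQ' (n : ℕ) : ‖qF p lam n‖ ≤ Q := hQ _ ⟨n, rfl⟩
  have hQ0 : 0 ≤ Q := (norm_nonneg _).trans (hQ' 0)
  have hq (i : ℕ) : p * qF p lam (i + 2) + (1 - p) - qF p lam i * qF p lam (i + 1) = 0 := by
    rw [qF]
    field_simp
    ring
  refine ⟨1 + Q, by positivity, fun m hm => ?_⟩
  let r (k : ℕ) : ℂ := if k < 2 * m then qF p lam k else 0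
  have hr (k : ℕ) (hk : 2 * m ≤ k) : r k = 0 := if_neg (by omega)
  have hr' (k : ℕ) (hk : k < 2 * m) : r k = qF p lam k := if_pos hk
  have hd (i : ℕ) (hi : i + 2 < 2 * m) : p * r (i + 2) + (1 - p) - r i * r (i + 1) = 0 := by
    rw [hr' _ hi, hr' i (by omega), hr' (i + 1) (by omega), hq]
  have hnp : ‖(p : ℂ)‖ = p := by rw [Complex.norm_real, Real.norm_of_nonneg hp0.le]
  -- The defect is `0` before the cut, `-p q_{i+2}` when only `r (i+2)` is cut among the last two
  -- factors, and `1 - p` once `r (i+1)` is cut too.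
  have hD (i : ℕ) : ‖p * r (i + 2) + (1 - p) - r i * r (i + 1)‖ ≤ 1 + Q := by
    by_cases h1 : i + 2 < 2 * m
    · rw [hd i h1, norm_zero]
      positivity
    · rw [hr (i + 2) (by omega)]
      by_cases h2 : i + 1 < 2 * m
      · rw [hr' i (by omega), hr' (i + 1) h2,
          show (p : ℂ) * 0 + (1 - p) - qF p lam i * qF p lam (i + 1) = -(p * qF p lam (i + 2)) by
            linear_combination hq i, norm_neg, norm_mul, hnp]
        have := mul_le_mul hp1.le (hQ' (i + 2)) (norm_nonneg _) zero_le_one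
        linarith
      · rw [hr (i + 1) (by omega), mul_zero, mul_zero, zero_add, sub_zero, ← Complex.ofReal_one,
          ← Complex.ofReal_sub, Complex.norm_real, Real.norm_of_nonneg (by linarith)]
        linarith
  have hr1 : r 1 = r 0 ^ 2 := by
    rw [hr' 1 (by omega), hr' 0 (by omega), qF, qF]
  have hlam0 : p * r 0 + (1 - p) = lam := by
    rw [hr' 0 (by omega), qF]
    field_simp
    ring
  refine ⟨natWeight r, finite_support_natWeight hr, by simp [natWeight], fun N => ?_⟩
  have key := transition_natWeight hp0.le hm hr hr1 hd hD N
  rw [hlam0] at key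
  obtain h | ⟨e, s, hs, hN, h⟩ := key
  · rw [h, norm_zero]
    have := add_nonneg (hb0 false N) (hb0 true N)
    positivity
  · have h1 : √p ^ s ≤ b false N + b true N := by
      rw [← hb e s, ← hN]
      cases e
      · linarith [hb0 true N]
      · linarith [hb0 false N]
    have h2 : p ^ s = √p ^ s * √p ^ s := by rw [← mul_pow, Real.mul_self_sqrt hp0.le]
    have h3 : √p ^ s ≤ √p ^ m := pow_le_pow_of_le_one hq0 hq1.le hs
    calc _ ≤ p ^ s * (1 + Q) := h
      _ = (1 + Q) * (√p ^ s * √p ^ s) := by rw [h2]; ring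
      _ ≤ (1 + Q) * (√p ^ m * (b false N + b true N)) := by gcongr
      _ = _ := by ring

/-- An inverse `T` of `lam - S` would give `1 ≤ ‖x‖ ≤ ‖T‖ ‖(lam - S) x‖` for the approximate
eigenvectors, whose right side tends to `0`. The isometry `ι` treats `ℓ^α`, `c0` and `c` together.
-/
theorem E_subset_spectrum (hp0 : 0 < p) (hp1 : p < 1) {α : ℝ≥0∞} [hα : Fact (1 ≤ α)] {X : Type*}
    [NormedAddCommGroup X] [NormedSpace ℂ X] (ι : X →ₗᵢ[ℂ] lp (fun _ : ℕ => ℂ) α) (S : X →L[ℂ] X)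
    (hS : ∀ x N, ι (S x) N = transition p (ι x) N)
    (hfin : ∀ y : lp (fun _ : ℕ => ℂ) α, (Function.support (y : ℕ → ℂ)).Finite → ∃ x, ι x = y) :
    E p ⊆ spectrum ℂ S := by
  intro lam hlam
  rw [spectrum.mem_iff]
  rintro ⟨U, hU⟩
  have hα0 : α ≠ 0 := (zero_lt_one.trans_le hα.out).ne'
  have hq1 : √p < 1 := by rw [Real.sqrt_lt' one_pos]; simpa using hp1
  obtain ⟨B, hBs, hB0, hB⟩ := exists_approx_eigenvectors hp0 hp1
  obtain ⟨D, hD0, hD⟩ := hB lam hlam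
  let T : X →L[ℂ] X := (U⁻¹ : (X →L[ℂ] X)ˣ)
  have hT (x : X) : T (lam • x - S x) = x := by
    have h := DFunLike.congr_fun U.inv_mul x
    rw [hU] at h
    simpa [T, Algebra.algebraMap_eq_smul_one] using h
  have hBm : Memℓp (fun N => (B N : ℂ)) α := by
    have h1 : Memℓp (fun N => (B N : ℂ)) 1 := by
      refine memℓp_gen ?_
      simpa [abs_of_nonneg, hB0] using hBs
    exact h1.of_exponent_ge hα.out
  let β : lp (fun _ : ℕ => ℂ) α := ⟨fun N => (B N : ℂ), hBm⟩
  have hle (m : ℕ) (hm : 2 ≤ m) : 1 ≤ ‖T‖ * (D * √p ^ m * ‖β‖) := by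
    obtain ⟨w, hwf, hw0, hw⟩ := hD m hm
    have hwm : Memℓp w α := (memℓp_zero hwf).of_exponent_ge zero_le
    obtain ⟨x, hx⟩ := hfin ⟨w, hwm⟩ hwf
    have hxw : (ι x : ℕ → ℂ) = w := by rw [hx]
    have hx1 : 1 ≤ ‖x‖ := by
      have := lp.norm_apply_le_norm hα0 (ι x) 0
      rwa [hxw, hw0, norm_one, ι.norm_map] at this
    have herr : ‖lam • x - S x‖ ≤ D * √p ^ m * ‖β‖ := by
      have hc0 : 0 ≤ D * √p ^ m := by positivity
      rw [← ι.norm_map]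
      calc ‖ι (lam • x - S x)‖ ≤ ‖((D * √p ^ m : ℝ) : ℂ) • β‖ := by
            refine lp.norm_mono hα0 fun N => ?_
            have h1 : ι (lam • x - S x) N = lam * w N - transition p w N := by
              rw [map_sub, map_smul, ← hxw, ← hS]
              rfl
            have h2 : ‖(((D * √p ^ m : ℝ) : ℂ) • β) N‖ = D * √p ^ m * B N := by
              change ‖((D * √p ^ m : ℝ) : ℂ) * (B N : ℂ)‖ = _
              rw [norm_mul, Complex.norm_real, Complex.norm_real, Real.norm_of_nonneg hc0,
                Real.norm_of_nonneg (hB0 N)]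
            rw [h1, h2, norm_sub_rev]
            exact hw N
        _ ≤ _ := by
            rw [lp.norm_const_smul hα0, Complex.norm_real, Real.norm_of_nonneg hc0]
    calc 1 ≤ ‖x‖ := hx1
      _ = ‖T (lam • x - S x)‖ := by rw [hT]
      _ ≤ ‖T‖ * ‖lam • x - S x‖ := T.le_opNorm _
      _ ≤ _ := mul_le_mul_of_nonneg_left herr (norm_nonneg _)
  have hlim : Tendsto (fun m : ℕ => ‖T‖ * (D * √p ^ m * ‖β‖)) atTop (𝓝 0) := by
    have := (((tendsto_pow_atTop_nhds_zero_of_lt_one (Real.sqrt_nonneg p) hq1).const_mul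
      D).mul_const ‖β‖).const_mul ‖T‖
    simpa using this
  obtain ⟨m, hm, hm2⟩ := ((hlim.eventually_lt_const one_pos).and (eventually_ge_atTop 2)).exists
  exact absurd (hle m hm2) (not_le.2 hm)

theorem tendsto_zero_of_finite_support {x : ℕ → ℂ} (hx : (Function.support x).Finite) :
    Tendsto x atTop (𝓝 0) := by
  refine tendsto_const_nhds.congr' ?_
  rw [← Nat.cofinite_eq_atTop]
  filter_upwards [hx.compl_mem_cofinite] with N hN
  simpa using (Eq.symm (by simpa using hN) : (0 : ℂ) = x N)

/-- The transition operator on a subspace of `ℓ^∞` that contains `c₀` and is invariant. -/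
theorem exists_restricted_operator (hp0 : 0 < p) (hp1 : p < 1)
    (V : Submodule ℂ (lp (fun _ : ℕ => ℂ) ∞)) (hV : c0 ≤ V)
    (hinv : ∀ x ∈ V, ∀ y : lp (fun _ : ℕ => ℂ) ∞, (y : ℕ → ℂ) = transition p x → y ∈ V) :
    ∃ S : V →L[ℂ] V, (∀ x : V, IsTransition p (x.1 : ℕ → ℂ) ((S x).1 : ℕ → ℂ)) ∧
      E p ⊆ spectrum ℂ S := by
  obtain ⟨S, hS⟩ := exists_transition_operator hp0 hp1 ∞
  have hS' (x : lp (fun _ : ℕ => ℂ) ∞) : (S x : ℕ → ℂ) = transition p x := funext (hS x)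
  refine ⟨(S ∘L V.subtypeL).codRestrict V fun x => hinv x x.2 _ (hS' x), fun x => ?_, ?_⟩
  · change IsTransition p x.1 (S x.1)
    rw [hS']
    exact isTransition_transition p _
  · exact E_subset_spectrum hp0 hp1 V.subtypeₗᵢ _ (fun x N => hS x N)
      fun y hy => ⟨⟨y, hV (tendsto_zero_of_finite_support hy)⟩, rfl⟩

/-! ### The filled Julia set -/

/-- The substitution `z = p q + (1-p)` turns the recursion for `q` into `g`, which acts on pairs of
consecutive terms. -/
theorem iterate_g (hp0 : p ≠ 0) (lam : ℂ) (n : ℕ) :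
    (g p)^[n] (1 - p + (1 - lam - p) ^ 2 / p, lam) =
      (p * qF p lam (n + 1) + (1 - p), p * qF p lam n + (1 - p)) := by
  have hpc : (p : ℂ) ≠ 0 := by exact_mod_cast hp0
  induction n with
  | zero =>
    simp only [Function.iterate_zero, id, qF]
    ext
    · field_simp
      ring
    · field_simp
      ring
  | succ n ih =>
    rw [Function.iterate_succ_apply', ih, g]
    ext
    · rw [qF]
      field_simp
      ring
    · rfl

theorem E_eq_filledJulia (hp0 : p ≠ 0) :
    E p = {lam : ℂ | (1 - p + (1 - lam - p) ^ 2 / p, lam) ∈ filledJulia (g p)} := by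
  have hpc : (p : ℂ) ≠ 0 := by exact_mod_cast hp0
  ext lam
  simp only [E, filledJulia, Set.mem_ofPred_eq, iterate_g hp0]
  rw [isBounded_iff_forall_norm_le, isBounded_iff_forall_norm_le]
  simp only [Set.forall_mem_range]
  constructor
  · rintro ⟨C, hC⟩
    have h (n : ℕ) : ‖p * qF p lam n + (1 - p)‖ ≤ ‖(p : ℂ)‖ * C + ‖(1 - p : ℂ)‖ := by
      refine (norm_add_le _ _).trans ?_
      rw [norm_mul]
      gcongr
      exact hC n
    exact ⟨_, fun n => max_le (h (n + 1)) (h n)⟩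
  · rintro ⟨C, hC⟩
    refine ⟨(C + ‖(1 - p : ℂ)‖) / ‖(p : ℂ)‖, fun n => ?_⟩
    rw [le_div_iff₀ (norm_pos_iff.2 hpc), mul_comm, ← norm_mul]
    have h1 := (norm_snd_le _).trans (hC n)
    have h2 := norm_sub_le (p * qF p lam n + (1 - p)) (1 - p : ℂ)
    rw [add_sub_cancel_right] at h2
    dsimp only at h1
    linarith

end FibAdding

open FibAdding in
theorem theorem3 (p : ℝ) (hp0 : 0 < p) (hp1 : p < 1) :
    E p = {lam : ℂ | (1 - p + (1 - lam - p) ^ 2 / p, lam) ∈ filledJulia (g p)} ∧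
    -- the spaces ℓ^α for 1 ≤ α < ∞, and ℓ^∞
    (∀ (α : ℝ≥0∞) [Fact (1 ≤ α)],
      ∃ S : lp (fun _ : ℕ => ℂ) α →L[ℂ] lp (fun _ : ℕ => ℂ) α,
        (∀ x : lp (fun _ : ℕ => ℂ) α, IsTransition p (x : ℕ → ℂ) (S x : ℕ → ℂ)) ∧ E p ⊆ spectrum ℂ S) ∧
    (∃ S : c0 →L[ℂ] c0,
      (∀ x : c0, IsTransition p (x.1 : ℕ → ℂ) ((S x).1 : ℕ → ℂ)) ∧ E p ⊆ spectrum ℂ S) ∧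
    (∃ S : c →L[ℂ] c,
      (∀ x : c, IsTransition p (x.1 : ℕ → ℂ) ((S x).1 : ℕ → ℂ)) ∧ E p ⊆ spectrum ℂ S) := by
  refine ⟨E_eq_filledJulia hp0.ne', fun α _ => ?_, ?_, ?_⟩
  · obtain ⟨S, hS⟩ := exists_transition_operator hp0 hp1 α
    refine ⟨S, fun x => ?_, E_subset_spectrum hp0 hp1 LinearIsometry.id S hS
      fun y _ => ⟨y, rfl⟩⟩
    rw [show (S x : ℕ → ℂ) = transition p x from funext (hS x)]
    exact isTransition_transition p _
  · refine exists_restricted_operator hp0 hp1 c0 le_rfl fun x hx y hy => ?_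
    change Tendsto (y : ℕ → ℂ) atTop (𝓝 0)
    rw [hy]
    exact tendsto_transition_zero hp0 hp1 hx
  · refine exists_restricted_operator hp0 hp1 c (fun x hx => ⟨0, hx⟩) fun x hx y hy => ?_
    obtain ⟨l, hl⟩ := hx
    refine ⟨l, ?_⟩
    change Tendsto (y : ℕ → ℂ) atTop (𝓝 l)
    rw [hy]
    exact tendsto_transition hp0 hp1 hl
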